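/- Consider a finite discounted constrained Markov decision process with finite state space $\mathcal S$, finite action space $\mathcal A$, transition kernel $P$, initial distribution $\mu$, discount factor $\gamma\in[0,1)$, reward $r:\mathcal S\times\mathcal A\to\mathbb R$, costs $c_i:\mathcal S\times\mathcal A\to\mathbb R$ and thresholds $b_i\in\mathbb R$, $i=1,\dots,m$. For a policy $\pi$ put $V_f(\pi)=(1-\gamma)\,\mathbb E_{\pi,\,s_0\sim\mu}\big[\sum_{t\ge0}\gamma^t f(s_t,a_t)\big]$ and $d_\pi(s,a)=(1-\gamma)\sum_{t\ge0}\gamma^t\,\mathbb P_\pi(s_t=s)\,\pi(a|s)$. Assume that $\sum_a d_\pi(s,a)>0$ for every policy $\pi$ and every state $s$ (exploration). Let $\phi:(0,\infty)\to\mathbb R$ be convex and twice differentiable with $|\phi'(x)|\to+\infty$ as $x\searrow0$ (by convexity, equivalently $\phi'(x)\to-\infty$), let $\beta_1,\dots,\beta_m>0$, and set $$\Phi_{\mathrm C}(d)=\sum_{s,a}d(s,a)\log\frac{d(s,a)}{\sum_{a'}d(s,a')}+\sum_{i=1}^m\beta_i\,\phi\Big(b_i-\sum_{s,a}c_i(s,a)d(s,a)\Big).$$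 Let $\theta\mapsto\pi_\theta$, $\theta\in\mathbb R^p$, be a regular policy parametrization: it is differentiable, its image is the set of all policies with $\pi(a|s)>0$ for all $s,a$, and its Jacobian has maximal rank everywhere (its range is the space of all $v\in\mathbb R^{\mathcal S\times\mathcal A}$ with $\sum_a v(s,a)=0$ for all $s$). Write $d_\theta=d_{\pi_\theta}$, $V_r(\theta)=V_r(\pi_\theta)$, $\Theta_{\mathrm{safe}}=\{\theta: V_{c_i}(\pi_\theta)\le b_i\ \forall i\}$ and $\Theta_{\mathrm{safe}}^\circ=\{\theta: V_{c_i}(\pi_\theta)<b_i\ \forall i\}$; the latter is the set of safe parameters at which $\Phi_{\mathrm C}$ is defined. For $\theta\in\Theta_{\mathrm{safe}}^\circ$ let $G_{\mathrm C}(\theta)_{ij}=\partial_{\theta_i}d_\theta^\top\,\nabla^2\Phi_{\mathrm C}(d_\theta)\,\partial_{\theta_j}d_\theta$ and let $G_{\mathrm C}(\theta)^+$ be an arbitrary pseudo-inverse, i.e. $G_{\mathrm C}G_{\mathrm C}^+G_{\mathrm C}=G_{\mathrm C}$. **Theorem (Safety during training).** The safe parameters are invariant under the C-NPG gradient flow $$\partial_t\theta_t=G_{\mathrm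 C}(\theta_t)^+\,\nabla V_r(\theta_t).\qquad(*)$$ Precisely: let $I$ be an interval with least element $0$ (such as $[0,T]$, $[0,T)$ or $[0,\infty)$) and let $\theta:I\to\mathbb R^p$ be a continuous curve that satisfies $(*)$ at every time $t\in I$ at which the right-hand side is defined, that is, at which $\theta_t\in\Theta_{\mathrm{safe}}^\circ$. If $\theta_0\in\Theta_{\mathrm{safe}}^\circ$, then $\theta_t\in\Theta_{\mathrm{safe}}^\circ\subseteq\Theta_{\mathrm{safe}}$ for all $t\in I$. -/

import Mathlib

open Set Filter Topology

noncomputable section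

/-- A finite discounted constrained Markov decision process with states `S`, actions `A` and
constraints indexed by `ι`. -/
structure CMDP (S A ι : Type*) [Fintype S] where
  /-- transition kernel: `P s a s'` is the probability of moving to `s'` from `s` under `a` -/
  P : S → A → S → ℝ
  P_mem : ∀ s a, P s a ∈ stdSimplex ℝ S
  /-- reward -/
  r : S × A → ℝ
  /-- initial distribution -/
  μ : S → ℝ
  μ_mem : μ ∈ stdSimplex ℝ S
  /-- discount factor -/
  γ : ℝ
  γ_nonneg : 0 ≤ γ
  γ_lt_one : γ < 1
  /-- costs -/
  c : ι → S × A → ℝ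
  /-- cost thresholds -/
  b : ι → ℝ

namespace CMDP

variable {S A ι : Type*} [Fintype S] [Fintype A] [Fintype ι] {p : ℕ}

/-- `π s a` is the probability `π(a|s)`. -/
def IsPolicy (π : S → A → ℝ) : Prop := ∀ s, π s ∈ stdSimplex ℝ A

/-- The law of the state at time `t`, when the initial state has law `ν` and actions follow `π`. -/
def stateDist (M : CMDP S A ι) (π : S → A → ℝ) (ν : S → ℝ) : ℕ → S → ℝ
  | 0 => ν
  | t + 1 => fun s' => ∑ s, ∑ a, M.stateDist π ν t s * π s a * M.P s a s'

/-- `V_f^π(s) = (1 - γ) E_π[∑ₜ γᵗ f(sₜ, aₜ) | s₀ = s]`. -/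
def value [DecidableEq S] (M : CMDP S A ι) (f : S × A → ℝ) (π : S → A → ℝ) (s : S) : ℝ :=
  (1 - M.γ) * ∑' t : ℕ, M.γ ^ t *
    ∑ s', ∑ a, M.stateDist π (Pi.single s 1) t s' * π s' a * f (s', a)

/-- `V_f(π) = E_{s ∼ μ}[V_f^π(s)]`. -/
def V [DecidableEq S] (M : CMDP S A ι) (f : S × A → ℝ) (π : S → A → ℝ) : ℝ :=
  ∑ s, M.μ s * M.value f π s

/-- The discounted state-action occupancy measure
`d_π(s, a) = (1 - γ) ∑ₜ γᵗ P_π(sₜ = s) π(a|s)`. -/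
def occ (M : CMDP S A ι) (π : S → A → ℝ) : S × A → ℝ := fun x =>
  (1 - M.γ) * ∑' t : ℕ, M.γ ^ t * (M.stateDist π M.μ t x.1 * π x.1 x.2)

/-- Exploration: under every policy, every state has positive discounted occupancy. -/
def Exploration (M : CMDP S A ι) : Prop :=
  ∀ π : S → A → ℝ, IsPolicy π → ∀ s, 0 < ∑ a, M.occ π (s, a)

/-- The set of safe policies. -/
def safePolicies [DecidableEq S] (M : CMDP S A ι) : Set (S → A → ℝ) :=
  {π | IsPolicy π ∧ ∀ i, M.V (M.c i) π ≤ M.b i}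

/-- The negative conditional entropy `∑ d(s,a) log (d(s,a) / d(s))`, where
`d(s) = ∑ₐ d(s,a)`; thus `PhiK d_π = ∑ d_π(s,a) log π(a|s)`. -/
def PhiK (d : S × A → ℝ) : ℝ :=
  ∑ s, ∑ a, d (s, a) * Real.log (d (s, a) / ∑ a', d (s, a'))

/-- The constrained mirror function `Φ_C(d) = Φ_K(d) + ∑ᵢ βᵢ φ(bᵢ - cᵢᵀ d)`. -/
def PhiC (M : CMDP S A ι) (β : ι → ℝ) (φ : ℝ → ℝ) (d : S × A → ℝ) : ℝ :=
  PhiK d + ∑ i, β i * φ (M.b i - ∑ x, M.c i x * d x)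

/-- A regular policy parametrization `θ ↦ π_θ` on `ℝᵖ`: it is differentiable, surjective onto the
strictly positive policies (the relative interior of the policy polytope), and its Jacobian has
maximal rank everywhere, i.e. its range is the whole tangent space of the policy polytope. -/
structure IsRegularParam (π : (Fin p → ℝ) → S → A → ℝ) : Prop where
  differentiable : Differentiable ℝ π
  range_eq : Set.range π = {q | IsPolicy q ∧ ∀ s a, 0 < q s a}
  range_fderiv : ∀ θ, Set.range (fderiv ℝ π θ) = {v | ∀ s, ∑ a, v s a = 0}

/-- `Θ_safe`: the parameters of safe policies. -/
def safeParams [DecidableEq S] (M : CMDP S A ι) (π : (Fin p → ℝ) → S → A → ℝ) :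
    Set (Fin p → ℝ) :=
  {θ | π θ ∈ M.safePolicies}

/-- The safe parameters with strict cost inequalities. As `φ` lives on `(0, ∞)`, these are the
safe parameters at which `Φ_C`, and hence the flow, is defined. -/
def strictlySafeParams [DecidableEq S] (M : CMDP S A ι) (π : (Fin p → ℝ) → S → A → ℝ) :
    Set (Fin p → ℝ) :=
  {θ | IsPolicy (π θ) ∧ ∀ i, M.V (M.c i) (π θ) < M.b i}

/-- The partial derivative `∂_{θᵢ} d_θ` of the occupancy measure. -/
def dOcc (M : CMDP S A ι) (π : (Fin p → ℝ) → S → A → ℝ) (θ : Fin p → ℝ) (i : Fin p) :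
    S × A → ℝ :=
  fderiv ℝ (fun θ' => M.occ (π θ')) θ (Pi.single i 1)

/-- The Gram matrix `G_C(θ)ᵢⱼ = ∂_{θᵢ} d_θᵀ ∇²Φ_C(d_θ) ∂_{θⱼ} d_θ`, with the Hessian as a
bilinear form. -/
def gramC (M : CMDP S A ι) (β : ι → ℝ) (φ : ℝ → ℝ) (π : (Fin p → ℝ) → S → A → ℝ)
    (θ : Fin p → ℝ) : Matrix (Fin p) (Fin p) ℝ :=
  Matrix.of fun i j =>
    fderiv ℝ (fderiv ℝ (M.PhiC β φ)) (M.occ (π θ)) (M.dOcc π θ i) (M.dOcc π θ j)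

/-- The gradient `∇V_r(θ)` of `θ ↦ V_r(π_θ)`. -/
def gradV [DecidableEq S] (M : CMDP S A ι) (π : (Fin p → ℝ) → S → A → ℝ)
    (θ : Fin p → ℝ) : Fin p → ℝ :=
  fun i => fderiv ℝ (fun θ' => M.V M.r (π θ')) θ (Pi.single i 1)

/-- `X` is a pseudo-inverse (generalized inverse) of `G`. Every generalized inverse is admitted, in
particular the Moore-Penrose inverse. -/
def IsPseudoInverse (G X : Matrix (Fin p) (Fin p) ℝ) : Prop := G * X * G = G

/-- `θ` is a continuous curve on the time interval `I` that satisfies the C-NPG flow equation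
`∂ₜ θₜ = G_C(θₜ)⁺ ∇V_r(θₜ)` at every time at which its right-hand side is defined, that is, at
which the cost constraints hold strictly. At all other times nothing but continuity is required,
so being a solution does not presuppose safety. -/
structure IsCNPGSolution [DecidableEq S] (M : CMDP S A ι) (π : (Fin p → ℝ) → S → A → ℝ)
    (Gplus : (Fin p → ℝ) → Matrix (Fin p) (Fin p) ℝ) (I : Set ℝ) (θ : ℝ → Fin p → ℝ) : Prop where
  continuousOn : ContinuousOn θ I
  hasDeriv : ∀ t ∈ I, θ t ∈ M.strictlySafeParams π →
    HasDerivWithinAt θ ((Gplus (θ t)).mulVec (M.gradV π (θ t))) I t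

end CMDP

end

set_option linter.unusedSectionVars false

noncomputable section

namespace CMDP

variable {S A ι : Type*} [Fintype S] [Fintype A] [Fintype ι] {p : ℕ}

/-! In occupancy space the flow is the gradient flow of the linear reward for the Hessian metric of
`PhiC`. Hence, for a fixed tangent vector `v` of the occupancy polytope, `∇Φ_C(d_t)·v` has the
constant velocity `r·v` (`hasDerivWithinAt_gradPhiC_occ`) and stays bounded in finite time.

Suppose `τ` is the first time at which a constraint is active, and test with `v = d_0 - d_τ`. The
entropy part of `∇Φ_C(d_t)·v` converges as `t ↑ τ`, since `d_τ` is still strictly positive. With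
slacks `x_i(t) = b_i - c_i·d_t`, the barrier part is `∑ β_i φ'(x_i(t)) (x_i(0) - x_i(τ))`. Active
constraints drive it to `-∞` and the others stay bounded (`tendsto_sum_barrier_atBot`), a
contradiction.

The reduction to occupancy space rests on two facts: the derivative of `θ ↦ d_θ` maps onto the
tangent space (`exists_fderiv_occ_eq`), and the Hessian is definite there, so every generalized
inverse yields the same direction in occupancy space (`hessPhiC_naturalGradient`). -/

/-! ### State laws, occupancy measures and the Bellman flow equation. -/

theorem sum_sum_mul_transition (M : CMDP S A ι) {π : S → A → ℝ} (hπ : IsPolicy π) (x : S → ℝ) :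
    ∑ s', ∑ s, ∑ a, x s * π s a * M.P s a s' = ∑ s, x s := by
  rw [Finset.sum_comm]
  refine Finset.sum_congr rfl fun s _ => ?_
  rw [Finset.sum_comm]
  simp_rw [← Finset.mul_sum, (M.P_mem s _).2, mul_one]
  rw [← Finset.mul_sum, (hπ s).2, mul_one]

theorem stateDist_mem (M : CMDP S A ι) {π : S → A → ℝ} (hπ : IsPolicy π) {ν : S → ℝ}
    (hν : ν ∈ stdSimplex ℝ S) (t : ℕ) : M.stateDist π ν t ∈ stdSimplex ℝ S := by
  induction t with
  | zero => exact hν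
  | succ t ih =>
    refine ⟨fun s' => Finset.sum_nonneg fun s _ => Finset.sum_nonneg fun a _ =>
      mul_nonneg (mul_nonneg (ih.1 s) ((hπ s).1 a)) ((M.P_mem s a).1 s'), ?_⟩
    exact (M.sum_sum_mul_transition hπ _).trans ih.2

/-- Linearity in the initial law; it links `value`, which starts from point masses, to `occ`, which
starts from `μ`. -/
theorem stateDist_mixture [DecidableEq S] (M : CMDP S A ι) (π : S → A → ℝ) (ν : S → ℝ) (t : ℕ)
    (s' : S) : ∑ s, ν s * M.stateDist π (Pi.single s 1) t s' = M.stateDist π ν t s' := by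
  induction t generalizing s' with
  | zero => simp [stateDist, Pi.single_apply]
  | succ t ih =>
    simp only [stateDist, Finset.mul_sum]
    rw [Finset.sum_comm]
    refine Finset.sum_congr rfl fun s _ => ?_
    rw [Finset.sum_comm]
    refine Finset.sum_congr rfl fun a _ => ?_
    rw [← ih s, Finset.sum_mul, Finset.sum_mul]
    exact Finset.sum_congr rfl fun _ _ => by ring

theorem summable_discounted_stateDist (M : CMDP S A ι) {π : S → A → ℝ} (hπ : IsPolicy π)
    {ν : S → ℝ} (hν : ν ∈ stdSimplex ℝ S) (s : S) :
    Summable fun t : ℕ => M.γ ^ t * M.stateDist π ν t s := by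
  refine Summable.of_nonneg_of_le (fun t => mul_nonneg (pow_nonneg M.γ_nonneg t)
    ((M.stateDist_mem hπ hν t).1 s)) (fun t => ?_)
    (summable_geometric_of_lt_one M.γ_nonneg M.γ_lt_one)
  refine mul_le_of_le_one_right (pow_nonneg M.γ_nonneg t) ?_
  have h := M.stateDist_mem hπ hν t
  rw [← h.2]
  exact Finset.single_le_sum (fun i _ => h.1 i) (Finset.mem_univ s)

/-- The discounted state occupancy measure. -/
def stateOcc (M : CMDP S A ι) (π : S → A → ℝ) (s : S) : ℝ :=
  (1 - M.γ) * ∑' t : ℕ, M.γ ^ t * M.stateDist π M.μ t s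

theorem occ_apply (M : CMDP S A ι) (π : S → A → ℝ) (x : S × A) :
    M.occ π x = M.stateOcc π x.1 * π x.1 x.2 := by
  simp only [occ, stateOcc, ← mul_assoc, tsum_mul_right]

theorem sum_occ (M : CMDP S A ι) {π : S → A → ℝ} (hπ : IsPolicy π) (s : S) :
    ∑ a, M.occ π (s, a) = M.stateOcc π s := by
  simp only [occ_apply]
  rw [← Finset.mul_sum, (hπ s).2, mul_one]

/-- Split off the term `t = 0` of the discounted series; the remaining terms are `γ` times one
transition step applied to the whole series. -/
theorem stateOcc_flow (M : CMDP S A ι) {π : S → A → ℝ} (hπ : IsPolicy π) (s' : S) :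
    M.stateOcc π s' =
      (1 - M.γ) * M.μ s' + M.γ * ∑ s, ∑ a, M.stateOcc π s * π s a * M.P s a s' := by
  have hs := fun s => M.summable_discounted_stateDist hπ M.μ_mem s
  have h2 : ∀ s a, Summable fun t : ℕ =>
      M.γ ^ t * M.stateDist π M.μ t s * π s a * M.P s a s' := fun s a =>
    ((hs s).mul_right _).mul_right _
  have key : ∑' t : ℕ, M.γ ^ t * M.stateDist π M.μ (t + 1) s' =
      ∑ s, ∑ a, (∑' t : ℕ, M.γ ^ t * M.stateDist π M.μ t s) * π s a * M.P s a s' := by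
    simp_rw [← tsum_mul_right]
    simp_rw [← Summable.tsum_finsetSum fun a _ => h2 _ a]
    rw [← Summable.tsum_finsetSum fun s _ => summable_sum fun a _ => h2 s a]
    refine tsum_congr fun t => ?_
    simp only [stateDist, Finset.mul_sum]
    exact Finset.sum_congr rfl fun _ _ => Finset.sum_congr rfl fun _ _ => by ring
  unfold stateOcc
  rw [(hs s').tsum_eq_zero_add]
  simp_rw [pow_succ, mul_comm _ M.γ, mul_assoc M.γ, tsum_mul_left, key, Finset.mul_sum]
  simp only [pow_zero, stateDist, one_mul, mul_add, Finset.mul_sum]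
  congr 1
  exact Finset.sum_congr rfl fun _ _ => Finset.sum_congr rfl fun _ _ => by ring

theorem V_eq_sum_occ [DecidableEq S] (M : CMDP S A ι) (f : S × A → ℝ) {π : S → A → ℝ}
    (hπ : IsPolicy π) : M.V f π = ∑ x, f x * M.occ π x := by
  have hs : ∀ s s', Summable fun t : ℕ => M.γ ^ t * M.stateDist π (Pi.single s 1) t s' :=
    fun s s' => M.summable_discounted_stateDist hπ (single_mem_stdSimplex ℝ s) s'
  have h2 : ∀ s s' a, Summable fun t : ℕ =>
      M.γ ^ t * M.stateDist π (Pi.single s 1) t s' * (π s' a * f (s', a)) :=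
    fun s s' a => (hs s s').mul_right _
  have hval : ∀ s, M.value f π s = ∑ s', ∑ a, (1 - M.γ) *
      ((∑' t : ℕ, M.γ ^ t * M.stateDist π (Pi.single s 1) t s') * (π s' a * f (s', a))) := by
    intro s
    have e : ∀ t, M.γ ^ t * ∑ s', ∑ a, M.stateDist π (Pi.single s 1) t s' * π s' a * f (s', a) =
        ∑ s', ∑ a, M.γ ^ t * M.stateDist π (Pi.single s 1) t s' * (π s' a * f (s', a)) := by
      intro t
      simp only [Finset.mul_sum]
      exact Finset.sum_congr rfl fun _ _ => Finset.sum_congr rfl fun _ _ => by ring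
    rw [value, tsum_congr e, Summable.tsum_finsetSum fun s' _ => summable_sum fun a _ => h2 s s' a,
      Finset.mul_sum]
    refine Finset.sum_congr rfl fun s' _ => ?_
    rw [Summable.tsum_finsetSum fun a _ => h2 s s' a, Finset.mul_sum]
    exact Finset.sum_congr rfl fun a _ => by rw [tsum_mul_right]
  have hocc : ∀ s', M.stateOcc π s' = ∑ s, M.μ s * ((1 - M.γ) *
      ∑' t : ℕ, M.γ ^ t * M.stateDist π (Pi.single s 1) t s') := by
    intro s'
    simp_rw [mul_left_comm _ (1 - M.γ)]
    rw [← Finset.mul_sum]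
    simp_rw [← tsum_mul_left (a := M.μ _)]
    rw [← Summable.tsum_finsetSum fun s _ => (hs s s').mul_left _, stateOcc]
    congr 1
    refine tsum_congr fun t => ?_
    rw [← stateDist_mixture, Finset.mul_sum]
    exact Finset.sum_congr rfl fun _ _ => by ring
  simp only [V, hval, Fintype.sum_prod_type, occ_apply, hocc, Finset.mul_sum, Finset.sum_mul]
  rw [Finset.sum_comm]
  refine Finset.sum_congr rfl fun s' _ => ?_
  rw [Finset.sum_comm]
  exact Finset.sum_congr rfl fun _ _ => Finset.sum_congr rfl fun _ _ => by ring

/-! ### The resolvent formula and differentiability of the occupancy measure. -/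

/-- The operator `x ↦ ∑ₛ ∑ₐ x(s) π(a|s) P(·|s,a)` on state measures, as a function of `π`. -/
def transitionOp (M : CMDP S A ι) : (S → A → ℝ) →L[ℝ] (S → ℝ) →L[ℝ] (S → ℝ) :=
  LinearMap.toContinuousLinearMap
    ((LinearMap.toContinuousLinearMap (𝕜 := ℝ) (E := S → ℝ) (F' := S → ℝ)).toLinearMap ∘ₗ
      LinearMap.mk₂ ℝ (fun (π : S → A → ℝ) (x : S → ℝ) (s' : S) =>
          ∑ s, ∑ a, x s * π s a * M.P s a s')
        (fun π π' x => by
          ext s'; simp [mul_add, add_mul, Finset.sum_add_distrib])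
        (fun c π x => by
          ext s'; simp only [Pi.smul_apply, smul_eq_mul, Finset.mul_sum]
          exact Finset.sum_congr rfl fun _ _ => Finset.sum_congr rfl fun _ _ => by ring)
        (fun π x y => by
          ext s'; simp [add_mul, Finset.sum_add_distrib])
        (fun c π x => by
          ext s'; simp only [Pi.smul_apply, smul_eq_mul, Finset.mul_sum]
          exact Finset.sum_congr rfl fun _ _ => Finset.sum_congr rfl fun _ _ => by ring))

theorem transitionOp_apply (M : CMDP S A ι) (π : S → A → ℝ) (x : S → ℝ) (s' : S) :
    M.transitionOp π x s' = ∑ s, ∑ a, x s * π s a * M.P s a s' := rfl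

/-- A stochastic kernel does not increase the `ℓ¹` norm, so with the factor `γ < 1` the only fixed
point is zero. -/
theorem eq_zero_of_eq_discounted_transition (M : CMDP S A ι) {π : S → A → ℝ} (hπ : IsPolicy π)
    {x : S → ℝ} (hx : ∀ s', x s' = M.γ * ∑ s, ∑ a, x s * π s a * M.P s a s') : x = 0 := by
  have hle : ∑ s, |x s| ≤ M.γ * ∑ s, |x s| := by
    -- Both sides are expanded; moving `γ` under the sum shields the right side, so the last rewrite
    -- folds back only the left one.
    rw [← M.sum_sum_mul_transition hπ fun s => |x s|, Finset.mul_sum,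
      M.sum_sum_mul_transition hπ fun s => |x s|]
    refine Finset.sum_le_sum fun s' _ => ?_
    conv_lhs => rw [hx s', abs_mul, abs_of_nonneg M.γ_nonneg]
    refine mul_le_mul_of_nonneg_left ?_ M.γ_nonneg
    refine (Finset.abs_sum_le_sum_abs _ _).trans (Finset.sum_le_sum fun s _ => ?_)
    refine (Finset.abs_sum_le_sum_abs _ _).trans (Finset.sum_le_sum fun a _ => ?_)
    rw [abs_mul, abs_mul, abs_of_nonneg ((hπ s).1 a), abs_of_nonneg ((M.P_mem s a).1 s')]
  have h0 : 0 ≤ ∑ s, |x s| := Finset.sum_nonneg fun s _ => abs_nonneg _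
  have h1 : ∑ s, |x s| = 0 := by nlinarith [M.γ_lt_one]
  ext s
  exact abs_eq_zero.1 ((Finset.sum_eq_zero_iff_of_nonneg fun s _ => abs_nonneg (x s)).1 h1 s
    (Finset.mem_univ s))

theorem isUnit_one_sub_transitionOp (M : CMDP S A ι) {π : S → A → ℝ} (hπ : IsPolicy π) :
    IsUnit (1 - M.γ • M.transitionOp π) := by
  rw [ContinuousLinearMap.isUnit_iff_bijective]
  have hinj : Function.Injective (1 - M.γ • M.transitionOp π : (S → ℝ) →L[ℝ] (S → ℝ)) := by
    rw [injective_iff_map_eq_zero]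
    intro x hx
    refine M.eq_zero_of_eq_discounted_transition hπ fun s' => ?_
    have := congrFun hx s'
    simpa [sub_eq_zero, transitionOp_apply] using this
  exact ⟨hinj, LinearMap.injective_iff_surjective.1 hinj⟩

/-- Solving the flow equation replaces the infinite series by an operator inverse, whose
differentiability in `π` is immediate. -/
theorem stateOcc_eq_inverse (M : CMDP S A ι) {π : S → A → ℝ} (hπ : IsPolicy π) :
    M.stateOcc π = Ring.inverse (1 - M.γ • M.transitionOp π) ((1 - M.γ) • M.μ) := by
  have h : (1 - M.γ • M.transitionOp π) (M.stateOcc π) = (1 - M.γ) • M.μ := by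
    ext s'
    have := M.stateOcc_flow hπ s'
    simp only [sub_apply, one_apply_eq_self, smul_apply, Pi.sub_apply, Pi.smul_apply, smul_eq_mul,
      transitionOp_apply]
    linarith
  rw [← h, ← mul_apply_eq_comp,
    Ring.inverse_mul_cancel _ (M.isUnit_one_sub_transitionOp hπ), one_apply_eq_self]

theorem IsRegularParam.isPolicy {π : (Fin p → ℝ) → S → A → ℝ} (hπ : IsRegularParam π)
    (θ : Fin p → ℝ) : IsPolicy (π θ) :=
  (hπ.range_eq.subset ⟨θ, rfl⟩).1

theorem IsRegularParam.pos {π : (Fin p → ℝ) → S → A → ℝ} (hπ : IsRegularParam π)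
    (θ : Fin p → ℝ) (s : S) (a : A) : 0 < π θ s a :=
  (hπ.range_eq.subset ⟨θ, rfl⟩).2 s a

theorem differentiable_stateOcc (M : CMDP S A ι) {π : (Fin p → ℝ) → S → A → ℝ}
    (hπ : IsRegularParam π) : Differentiable ℝ fun θ => M.stateOcc (π θ) := by
  have h : (fun θ => M.stateOcc (π θ)) = fun θ =>
      Ring.inverse (1 - M.γ • M.transitionOp (π θ)) ((1 - M.γ) • M.μ) :=
    funext fun θ => M.stateOcc_eq_inverse (hπ.isPolicy θ)
  rw [h]
  intro θ
  have h1 : DifferentiableAt ℝ (fun θ => 1 - M.γ • M.transitionOp (π θ)) θ :=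
    ((M.transitionOp.differentiableAt.comp θ (hπ.differentiable θ)).const_smul M.γ).const_sub 1
  have h2 := (differentiableAt_inverse (𝕜 := ℝ)
    (M.isUnit_one_sub_transitionOp (hπ.isPolicy θ))).comp θ h1
  exact h2.clm_apply (differentiableAt_const _)

theorem differentiable_occ (M : CMDP S A ι) {π : (Fin p → ℝ) → S → A → ℝ}
    (hπ : IsRegularParam π) : Differentiable ℝ fun θ => M.occ (π θ) := by
  rw [differentiable_pi]
  intro x
  simp only [occ_apply]
  have h1 := differentiable_pi.1 (M.differentiable_stateOcc hπ) x.1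
  have h2 := differentiable_pi.1 (differentiable_pi.1 hπ.differentiable x.1) x.2
  exact h1.mul h2

/-! ### The tangent space as the range of the derivative of `θ ↦ d_θ`. -/

/-- The tangent space of the polytope of occupancy measures: the signed measures on `S × A`
satisfying the homogeneous Bellman flow equation. -/
def occTangent (M : CMDP S A ι) : Submodule ℝ (S × A → ℝ) where
  carrier := {v | ∀ s', ∑ a, v (s', a) = M.γ * ∑ s, ∑ a, v (s, a) * M.P s a s'}
  zero_mem' := by simp
  add_mem' := by
    intro u v hu hv s'
    simp only [Pi.add_apply, add_mul, Finset.sum_add_distrib, mul_add, hu s', hv s']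
  smul_mem' := by
    intro c v hv s'
    simp only [Pi.smul_apply, smul_eq_mul, mul_assoc, ← Finset.mul_sum, hv s']
    ring

theorem occ_sub_occ_mem (M : CMDP S A ι) {π π' : S → A → ℝ} (hπ : IsPolicy π)
    (hπ' : IsPolicy π') : M.occ π - M.occ π' ∈ M.occTangent := by
  intro s'
  simp only [Pi.sub_apply, Finset.sum_sub_distrib, sub_mul, M.sum_occ hπ, M.sum_occ hπ']
  simp only [occ_apply]
  rw [M.stateOcc_flow hπ s', M.stateOcc_flow hπ' s']
  ring

/-- A tangent direction that leaves the policy unchanged is zero: its state part solves the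
homogeneous discounted equation. This gives both the surjectivity of the occupancy derivative and
the definiteness of the Hessian. -/
theorem eq_zero_of_mem_occTangent (M : CMDP S A ι) {π : S → A → ℝ} (hπ : IsPolicy π)
    {v : S × A → ℝ} (hv : v ∈ M.occTangent) {x : S → ℝ} (hx : ∀ s a, v (s, a) = x s * π s a) :
    v = 0 := by
  have h : x = 0 := by
    refine M.eq_zero_of_eq_discounted_transition hπ fun s' => ?_
    have := hv s'
    simp only [hx] at this
    rwa [← Finset.mul_sum, (hπ s').2, mul_one] at this
  ext ⟨s, a⟩
  simp [hx, h]

theorem fderiv_occ_mem (M : CMDP S A ι) {π : (Fin p → ℝ) → S → A → ℝ}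
    (hπ : IsRegularParam π) (θ x : Fin p → ℝ) :
    fderiv ℝ (fun θ => M.occ (π θ)) θ x ∈ M.occTangent := by
  have hd := (M.differentiable_occ hπ θ).hasFDerivAt
  have hc : ∀ y, HasFDerivAt (fun θ => M.occ (π θ) y)
      ((ContinuousLinearMap.proj y).comp (fderiv ℝ (fun θ => M.occ (π θ)) θ)) θ :=
    fun y => (hasFDerivAt_pi'.1 hd) y
  intro s'
  have h1 := HasFDerivAt.fun_sum (u := Finset.univ) fun a _ => hc (s', a)
  have h2 := ((HasFDerivAt.fun_sum (u := Finset.univ) fun s _ =>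
    HasFDerivAt.fun_sum (u := Finset.univ) fun a _ =>
      (hc (s, a)).mul_const (M.P s a s')).const_mul M.γ).const_add ((1 - M.γ) * M.μ s')
  have h3 : (fun θ => ∑ a, M.occ (π θ) (s', a)) = fun θ =>
      (1 - M.γ) * M.μ s' + M.γ * ∑ s, ∑ a, M.occ (π θ) (s, a) * M.P s a s' := by
    funext θ
    rw [M.sum_occ (hπ.isPolicy θ)]
    simp only [occ_apply]
    exact M.stateOcc_flow (hπ.isPolicy θ) s'
  rw [h3] at h1
  have h4 := DFunLike.congr_fun (h1.unique h2) x
  simpa [mul_comm] using h4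

/-- Write `d = ρ π` with `ρ` the state marginal. The product rule `v = ρ' π + ρ π'`, with `ρ'` the
marginal of `v`, dictates `π'`; its rows sum to zero, so maximal rank realizes it. The resulting
derivative differs from `v` by a tangent vector of the form `x(s) π(a|s)`, which vanishes. -/
theorem exists_fderiv_occ_eq (M : CMDP S A ι) (hM : M.Exploration)
    {π : (Fin p → ℝ) → S → A → ℝ} (hπ : IsRegularParam π) (θ : Fin p → ℝ) {v : S × A → ℝ}
    (hv : v ∈ M.occTangent) : ∃ x, fderiv ℝ (fun θ => M.occ (π θ)) θ x = v := by
  have hpol := hπ.isPolicy θ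
  have hpos : ∀ s, 0 < M.stateOcc (π θ) s := fun s => by
    rw [← M.sum_occ hpol]; exact hM _ hpol s
  obtain ⟨x, hx⟩ : (fun s a => (v (s, a) - (∑ a', v (s, a')) * π θ s a) / M.stateOcc (π θ) s) ∈
      Set.range (fderiv ℝ π θ) := by
    rw [hπ.range_fderiv θ]
    intro s
    rw [← Finset.sum_div, Finset.sum_sub_distrib, ← Finset.mul_sum, (hpol s).2]
    simp
  refine ⟨x, ?_⟩
  rw [← sub_eq_zero]
  refine M.eq_zero_of_mem_occTangent hpol
    (x := fun s => fderiv ℝ (fun θ => M.stateOcc (π θ)) θ x s - ∑ a', v (s, a'))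
    (Submodule.sub_mem _ (M.fderiv_occ_mem hπ θ x) hv) fun s a => ?_
  have h1 := hasFDerivAt_pi'.1 (M.differentiable_occ hπ θ).hasFDerivAt (s, a)
  have h2 := hasFDerivAt_pi'.1 (M.differentiable_stateOcc hπ θ).hasFDerivAt s
  have h3 := hasFDerivAt_pi'.1 (hasFDerivAt_pi'.1 (hπ.differentiable θ).hasFDerivAt s) a
  simp only [occ_apply] at h1
  have h4 := DFunLike.congr_fun (h1.unique (h2.mul h3)) x
  simp [hx] at h4
  rw [Pi.sub_apply, h4]
  field_simp [(hpos s).ne']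
  ring

/-! ### First and second derivatives of the mirror function. -/

/-- The state marginal `d ↦ ∑ₐ d(s,a)`. -/
def marginal (s : S) : (S × A → ℝ) →L[ℝ] ℝ := ∑ a, ContinuousLinearMap.proj (s, a)

theorem marginal_apply (s : S) (d : S × A → ℝ) : marginal s d = ∑ a, d (s, a) := by
  simp [marginal]

/-- The linear functional `d ↦ fᵀ d`. -/
def pairing (f : S × A → ℝ) : (S × A → ℝ) →L[ℝ] ℝ := ∑ x, f x • ContinuousLinearMap.proj x

theorem pairing_apply (f d : S × A → ℝ) : pairing f d = ∑ x, f x * d x := by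
  simp [pairing]

/-- The differential of `PhiK`. -/
def gradPhiK (d : S × A → ℝ) : (S × A → ℝ) →L[ℝ] ℝ :=
  ∑ s, ∑ a, (Real.log (d (s, a)) - Real.log (marginal s d)) • ContinuousLinearMap.proj (s, a)

/-- The differential of `PhiC`. -/
def gradPhiC (M : CMDP S A ι) (β : ι → ℝ) (φ : ℝ → ℝ) (d : S × A → ℝ) : (S × A → ℝ) →L[ℝ] ℝ :=
  gradPhiK d + ∑ i, (β i * deriv φ (M.b i - pairing (M.c i) d)) • -pairing (M.c i)

/-- The Hessian of `PhiK` as a bilinear form. -/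
def hessPhiK (d u v : S × A → ℝ) : ℝ :=
  ∑ s, ∑ a, (u (s, a) / d (s, a) - marginal s u / marginal s d) * v (s, a)

/-- The Hessian of `PhiC` as a bilinear form. -/
def hessPhiC (M : CMDP S A ι) (β : ι → ℝ) (φ : ℝ → ℝ) (d u v : S × A → ℝ) : ℝ :=
  hessPhiK d u v + ∑ i, β i * deriv (deriv φ) (M.b i - pairing (M.c i) d) *
    (pairing (M.c i) u * pairing (M.c i) v)

theorem marginal_pos [Nonempty A] {d : S × A → ℝ} (hd : ∀ x, 0 < d x) (s : S) :
    0 < marginal s d := by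
  rw [marginal_apply]
  exact Finset.sum_pos (fun a _ => hd _) Finset.univ_nonempty

theorem hasFDerivAt_PhiK [Nonempty A] {d : S × A → ℝ} (hd : ∀ x, 0 < d x) :
    HasFDerivAt (PhiK (S := S) (A := A)) (gradPhiK d) d := by
  have hm := marginal_pos hd
  have hterm : ∀ s a, HasFDerivAt (fun d : S × A → ℝ => d (s, a) * Real.log (d (s, a) / ∑ a', d (s, a')))
      ((Real.log (d (s, a)) - Real.log (marginal s d)) •
        (ContinuousLinearMap.proj (s, a) : (S × A → ℝ) →L[ℝ] ℝ) +
        ((ContinuousLinearMap.proj (s, a) : (S × A → ℝ) →L[ℝ] ℝ) -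
          (d (s, a) / marginal s d) • marginal s)) d := by
    intro s a
    have h1 : HasFDerivAt (fun d : S × A → ℝ => d (s, a))
      (ContinuousLinearMap.proj (s, a) : (S × A → ℝ) →L[ℝ] ℝ) d := hasFDerivAt_apply (s, a) d
    have h2 : HasFDerivAt (fun d : S × A → ℝ => marginal s d) (marginal s) d :=
      (marginal s).hasFDerivAt
    have h3 := h1.mul ((h1.log (hd _).ne').sub (h2.log (hm s).ne'))
    refine (h3.congr_of_eventuallyEq ?_).congr_fderiv ?_
    · have e1 : ∀ᶠ d' : S × A → ℝ in 𝓝 d, 0 < d' (s, a) :=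
        h1.continuousAt.eventually (lt_mem_nhds (hd (s, a)))
      have e2 : ∀ᶠ d' : S × A → ℝ in 𝓝 d, 0 < marginal s d' :=
        h2.continuousAt.eventually (lt_mem_nhds (hm s))
      filter_upwards [e1, e2] with d' h1' h2'
      rw [← marginal_apply, Real.log_div h1'.ne' h2'.ne']
      rfl
    · ext v
      have := (hd (s, a)).ne'
      simp [smul_eq_mul]
      field_simp
      ring
  have h := HasFDerivAt.fun_sum (u := Finset.univ) fun s _ =>
    HasFDerivAt.fun_sum (u := Finset.univ) fun a _ => hterm s a
  refine h.congr_fderiv ?_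
  rw [gradPhiK]
  -- The terms from differentiating the logarithm cancel when summed over the actions of each state.
  refine Finset.sum_congr rfl fun s _ => ?_
  rw [Finset.sum_add_distrib, Finset.sum_sub_distrib, ← Finset.sum_smul, ← Finset.sum_div,
    ← marginal_apply, div_self (hm s).ne', one_smul]
  simp [marginal]

/-- The interior of the domain of `PhiC`. -/
def domPhiC (M : CMDP S A ι) : Set (S × A → ℝ) :=
  {d | (∀ x, 0 < d x) ∧ ∀ i, 0 < M.b i - pairing (M.c i) d}

theorem isOpen_domPhiC (M : CMDP S A ι) : IsOpen M.domPhiC := by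
  have h1 : IsOpen {d : S × A → ℝ | ∀ x, 0 < d x} := by
    simp only [Set.ofPred_forall]
    exact isOpen_iInter_of_finite fun x => isOpen_lt continuous_const (continuous_apply x)
  have h2 : IsOpen {d : S × A → ℝ | ∀ i, 0 < M.b i - pairing (M.c i) d} := by
    simp only [Set.ofPred_forall]
    exact isOpen_iInter_of_finite fun i =>
      isOpen_lt continuous_const (continuous_const.sub (pairing (M.c i)).continuous)
  exact h1.inter h2

theorem hasFDerivAt_PhiC [Nonempty A] (M : CMDP S A ι) (β : ι → ℝ) {φ : ℝ → ℝ}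
    (hφ : DifferentiableOn ℝ φ (Ioi 0)) {d : S × A → ℝ} (hd : d ∈ M.domPhiC) :
    HasFDerivAt (M.PhiC β φ) (M.gradPhiC β φ d) d := by
  refine (hasFDerivAt_PhiK hd.1).add (HasFDerivAt.fun_sum (u := Finset.univ) fun i _ => ?_)
  simp only [← pairing_apply]
  have h1 : HasDerivAt φ (deriv φ (M.b i - pairing (M.c i) d)) (M.b i - pairing (M.c i) d) :=
    (hφ.differentiableAt (Ioi_mem_nhds (hd.2 i))).hasDerivAt
  have h2 := (h1.comp_hasFDerivAt d ((pairing (M.c i)).hasFDerivAt.const_sub (M.b i))).const_mul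
    (β i)
  exact h2.congr_fderiv (by rw [smul_smul])

theorem hasFDerivAt_gradPhiC [Nonempty A] (M : CMDP S A ι) (β : ι → ℝ) {φ : ℝ → ℝ}
    (hφ : DifferentiableOn ℝ (deriv φ) (Ioi 0)) {d : S × A → ℝ} (hd : d ∈ M.domPhiC) :
    ∃ L : (S × A → ℝ) →L[ℝ] (S × A → ℝ) →L[ℝ] ℝ, HasFDerivAt (M.gradPhiC β φ) L d ∧
      ∀ u v, L u v = M.hessPhiC β φ d u v := by
  have hlog : ∀ s a, HasFDerivAt
      (fun d : S × A → ℝ => Real.log (d (s, a)) - Real.log (marginal s d))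
      ((d (s, a))⁻¹ • (ContinuousLinearMap.proj (s, a) : (S × A → ℝ) →L[ℝ] ℝ) -
        (marginal s d)⁻¹ • marginal s) d := fun s a =>
    ((hasFDerivAt_apply (s, a) d).log (hd.1 _).ne').sub
      ((marginal s).hasFDerivAt.log (marginal_pos hd.1 s).ne')
  have hK := HasFDerivAt.fun_sum (u := Finset.univ) fun s _ =>
    HasFDerivAt.fun_sum (u := Finset.univ) fun a _ => (hlog s a).smul_const
      (ContinuousLinearMap.proj (s, a) : (S × A → ℝ) →L[ℝ] ℝ)
  have hi : ∀ i, HasFDerivAt (fun d => β i * deriv φ (M.b i - pairing (M.c i) d))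
      (β i • deriv (deriv φ) (M.b i - pairing (M.c i) d) • -pairing (M.c i)) d := fun i =>
    (HasDerivAt.comp_hasFDerivAt (h₂ := deriv φ) d
      (hφ.differentiableAt (Ioi_mem_nhds (hd.2 i))).hasDerivAt
      ((pairing (M.c i)).hasFDerivAt.const_sub (M.b i))).const_mul (β i)
  have hC := HasFDerivAt.fun_sum (u := Finset.univ) fun i _ =>
    (hi i).smul_const (-pairing (M.c i))
  refine ⟨_, hK.add hC, fun u v => ?_⟩
  simp [hessPhiC, hessPhiK, div_eq_inv_mul, mul_assoc]

theorem fderiv_fderiv_PhiC [Nonempty A] (M : CMDP S A ι) (β : ι → ℝ) {φ : ℝ → ℝ}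
    (hφ : DifferentiableOn ℝ φ (Ioi 0)) (hφ2 : DifferentiableOn ℝ (deriv φ) (Ioi 0))
    {d : S × A → ℝ} (hd : d ∈ M.domPhiC) (u v : S × A → ℝ) :
    fderiv ℝ (fderiv ℝ (M.PhiC β φ)) d u v = M.hessPhiC β φ d u v := by
  have h : fderiv ℝ (M.PhiC β φ) =ᶠ[𝓝 d] M.gradPhiC β φ := by
    filter_upwards [M.isOpen_domPhiC.mem_nhds hd] with d' hd'
    exact (M.hasFDerivAt_PhiC β hφ hd').fderiv
  obtain ⟨L, hL, hLuv⟩ := M.hasFDerivAt_gradPhiC β hφ2 hd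
  rw [h.fderiv_eq, hL.fderiv, hLuv]

/-! ### Positivity and kernel of the Hessian. -/

theorem hessPhiK_eq (d u v : S × A → ℝ) : hessPhiK d u v =
    ∑ s, (∑ a, u (s, a) * v (s, a) / d (s, a) - marginal s u * marginal s v / marginal s d) := by
  refine Finset.sum_congr rfl fun s _ => ?_
  simp only [sub_mul, Finset.sum_sub_distrib]
  rw [← Finset.mul_sum, ← marginal_apply s v]
  congr 1
  · exact Finset.sum_congr rfl fun a _ => by ring
  · ring

theorem hessPhiK_self [Nonempty A] {d : S × A → ℝ} (hd : ∀ x, 0 < d x) (u : S × A → ℝ) :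
    hessPhiK d u u =
      ∑ s, ∑ a, d (s, a) * (u (s, a) / d (s, a) - marginal s u / marginal s d) ^ 2 := by
  rw [hessPhiK_eq]
  refine Finset.sum_congr rfl fun s _ => ?_
  have hm := (marginal_pos hd s).ne'
  have h : ∀ a, d (s, a) * (u (s, a) / d (s, a) - marginal s u / marginal s d) ^ 2 =
      u (s, a) * u (s, a) / d (s, a) - 2 * (marginal s u / marginal s d) * u (s, a) +
        (marginal s u / marginal s d) ^ 2 * d (s, a) := by
    intro a
    have := (hd (s, a)).ne'
    field_simp
    ring
  simp only [h, Finset.sum_add_distrib, Finset.sum_sub_distrib]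
  rw [← Finset.mul_sum, ← Finset.mul_sum, ← marginal_apply, ← marginal_apply]
  field_simp
  ring

theorem hessPhiC_comm (M : CMDP S A ι) (β : ι → ℝ) (φ : ℝ → ℝ) (d u v : S × A → ℝ) :
    M.hessPhiC β φ d u v = M.hessPhiC β φ d v u := by
  simp only [hessPhiC, hessPhiK_eq, mul_comm (u _), mul_comm (marginal _ u),
    mul_comm (pairing _ u)]

/-- The entropy part is a weighted sum of squares and the barrier part is nonnegative by convexity,
so each vanishes. The squares then leave only directions that rescale `d` state by state. -/
theorem eq_mul_of_hessPhiC_self_eq_zero [Nonempty A] (M : CMDP S A ι) {β : ι → ℝ}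
    (hβ : ∀ i, 0 < β i) {φ : ℝ → ℝ} (hφ : MonotoneOn (deriv φ) (Ioi 0)) {d : S × A → ℝ}
    (hd : d ∈ M.domPhiC) {u : S × A → ℝ} (hu : M.hessPhiC β φ d u u = 0) (s : S) (a : A) :
    u (s, a) = marginal s u / marginal s d * d (s, a) := by
  have hC : 0 ≤ ∑ i, β i * deriv (deriv φ) (M.b i - pairing (M.c i) d) *
      (pairing (M.c i) u * pairing (M.c i) u) := by
    refine Finset.sum_nonneg fun i _ => mul_nonneg (mul_nonneg (hβ i).le ?_) (mul_self_nonneg _)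
    rw [← derivWithin_of_isOpen isOpen_Ioi (hd.2 i)]
    exact hφ.derivWithin_nonneg
  have hn : ∀ s a, 0 ≤ d (s, a) * (u (s, a) / d (s, a) - marginal s u / marginal s d) ^ 2 :=
    fun s a => mul_nonneg (hd.1 _).le (sq_nonneg _)
  have hK : hessPhiK d u u = 0 := by
    refine le_antisymm ?_ ?_
    · rw [hessPhiC] at hu; linarith
    · rw [hessPhiK_self hd.1]
      exact Finset.sum_nonneg fun s _ => Finset.sum_nonneg fun a _ => hn s a
  rw [hessPhiK_self hd.1,
    Finset.sum_eq_zero_iff_of_nonneg fun s _ => Finset.sum_nonneg fun a _ => hn s a] at hK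
  have h1 := (Finset.sum_eq_zero_iff_of_nonneg fun a _ => hn s a).1 (hK s (Finset.mem_univ s)) a
    (Finset.mem_univ a)
  have hne := (hd.1 (s, a)).ne'
  have h2 : u (s, a) / d (s, a) - marginal s u / marginal s d = 0 := by
    simpa [hne] using h1
  rw [← sub_eq_zero.1 h2, div_mul_cancel₀ _ hne]

theorem monotoneOn_deriv_of_convexOn {φ : ℝ → ℝ} (hφ : ConvexOn ℝ (Ioi 0) φ)
    (hd : DifferentiableOn ℝ φ (Ioi 0)) : MonotoneOn (deriv φ) (Ioi 0) :=
  hφ.monotoneOn_deriv fun _ hx => hd.differentiableAt (Ioi_mem_nhds hx)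

/-- Monotonicity bounds `φ'` on `(0, 1)` above by `φ' 1`, so once `|φ'|` exceeds `|φ' 1|` the sign
must be negative. -/
theorem tendsto_deriv_atBot_of_barrier {φ : ℝ → ℝ} (hφ : MonotoneOn (deriv φ) (Ioi 0))
    (hb : Tendsto (fun x => |deriv φ x|) (𝓝[>] 0) atTop) :
    Tendsto (deriv φ) (𝓝[>] 0) atBot := by
  rw [← tendsto_neg_atTop_iff]
  refine hb.congr' ?_
  filter_upwards [hb.eventually_gt_atTop |deriv φ 1|, Ioo_mem_nhdsGT one_pos] with x hx hx1
  have h1 := hφ hx1.1 (mem_Ioi.2 one_pos) hx1.2.le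
  refine abs_of_nonpos ?_
  by_contra! h
  rw [abs_of_pos h] at hx
  exact absurd (hx.trans_le h1) (not_lt.2 (le_abs_self _))

theorem IsPolicy.nonempty_action (M : CMDP S A ι) {π : S → A → ℝ} (hπ : IsPolicy π) :
    Nonempty A := by
  obtain ⟨s⟩ : Nonempty S := by
    by_contra! h
    simpa using M.μ_mem.2
  by_contra! h
  simpa using (hπ s).2

theorem mem_strictlySafeParams_iff [DecidableEq S] (M : CMDP S A ι)
    {π : (Fin p → ℝ) → S → A → ℝ} (hπ : IsRegularParam π) (θ : Fin p → ℝ) :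
    θ ∈ M.strictlySafeParams π ↔ ∀ i, 0 < M.b i - pairing (M.c i) (M.occ (π θ)) := by
  have h := hπ.isPolicy θ
  refine ⟨fun hθ i => ?_, fun hθ => ⟨h, fun i => ?_⟩⟩
  · have := hθ.2 i
    rw [V_eq_sum_occ M _ h, ← pairing_apply] at this
    linarith
  · have := hθ i
    rw [V_eq_sum_occ M _ h, ← pairing_apply]
    linarith

theorem occ_pos (M : CMDP S A ι) (hM : M.Exploration) {π : (Fin p → ℝ) → S → A → ℝ}
    (hπ : IsRegularParam π) (θ : Fin p → ℝ) (x : S × A) : 0 < M.occ (π θ) x := by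
  rw [occ_apply, ← M.sum_occ (hπ.isPolicy θ)]
  exact mul_pos (hM _ (hπ.isPolicy θ) _) (hπ.pos θ _ _)

theorem gradV_apply [DecidableEq S] (M : CMDP S A ι) {π : (Fin p → ℝ) → S → A → ℝ}
    (hπ : IsRegularParam π) (θ : Fin p → ℝ) (i : Fin p) :
    M.gradV π θ i = pairing M.r (M.dOcc π θ i) := by
  have h : (fun θ' => M.V M.r (π θ')) = fun θ' => pairing M.r (M.occ (π θ')) := by
    funext θ'
    rw [V_eq_sum_occ M _ (hπ.isPolicy θ'), pairing_apply]
  have h1 : HasFDerivAt (fun θ' => pairing M.r (M.occ (π θ'))) _ θ :=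
    (pairing M.r).hasFDerivAt.comp θ (M.differentiable_occ hπ θ).hasFDerivAt
  rw [gradV, h, dOcc, h1.fderiv]
  rfl

/-! ### The natural gradient as a Hessian gradient in occupancy space. -/

/-- The Hessian of `PhiC` represents the reward on the tangent space of occupancy measures. -/
theorem exists_hessPhiC_eq_pairing [Nonempty A] (M : CMDP S A ι) {β : ι → ℝ}
    (hβ : ∀ i, 0 < β i) {φ : ℝ → ℝ} (hφ : MonotoneOn (deriv φ) (Ioi 0))
    (hφ2 : DifferentiableOn ℝ (deriv φ) (Ioi 0)) {π : S → A → ℝ} (hπ : IsPolicy π)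
    (hd : M.occ π ∈ M.domPhiC) (f : S × A → ℝ) :
    ∃ w ∈ M.occTangent, ∀ v ∈ M.occTangent, M.hessPhiC β φ (M.occ π) w v = pairing f v := by
  obtain ⟨L, -, hL⟩ := M.hasFDerivAt_gradPhiC β hφ2 hd
  let B : M.occTangent →ₗ[ℝ] Module.Dual ℝ M.occTangent :=
    LinearMap.mk₂ ℝ (fun u v => L u v) (by simp) (by simp) (by simp) (by simp)
  -- Definiteness on the tangent space makes the map to the dual injective, hence onto by equality
  -- of dimensions.
  have hinj : Function.Injective B := by
    rw [injective_iff_map_eq_zero]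
    intro u hu
    have h0 : M.hessPhiC β φ (M.occ π) u u = 0 := by
      rw [← hL]; exact LinearMap.congr_fun hu u
    refine Subtype.ext (M.eq_zero_of_mem_occTangent hπ u.2
      (x := fun s => marginal s u.1 / marginal s (M.occ π) * M.stateOcc π s) fun s a => ?_)
    rw [M.eq_mul_of_hessPhiC_self_eq_zero hβ hφ hd h0 s a, occ_apply, mul_assoc]
  obtain ⟨w, hw⟩ := (LinearMap.injective_iff_surjective_of_finrank_eq_finrank
    (Subspace.dual_finrank_eq (K := ℝ) (V := M.occTangent)).symm).1 hinj
      ((pairing f).toLinearMap ∘ₗ M.occTangent.subtype)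
  exact ⟨w, w.2, fun v hv => by rw [← hL]; exact LinearMap.congr_fun hw ⟨v, hv⟩⟩

/-- The natural gradient direction, pushed forward to occupancy measures, is the gradient of the
reward with respect to the Hessian metric of `PhiC`. -/
theorem hessPhiC_naturalGradient [DecidableEq S] (M : CMDP S A ι) (hM : M.Exploration)
    {β : ι → ℝ} (hβ : ∀ i, 0 < β i) {φ : ℝ → ℝ} (hφ : MonotoneOn (deriv φ) (Ioi 0))
    (hφ1 : DifferentiableOn ℝ φ (Ioi 0)) (hφ2 : DifferentiableOn ℝ (deriv φ) (Ioi 0))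
    {π : (Fin p → ℝ) → S → A → ℝ} (hπ : IsRegularParam π) {θ : Fin p → ℝ}
    (hd : M.occ (π θ) ∈ M.domPhiC) {X : Matrix (Fin p) (Fin p) ℝ}
    (hX : IsPseudoInverse (M.gramC β φ π θ) X) {v : S × A → ℝ} (hv : v ∈ M.occTangent) :
    M.hessPhiC β φ (M.occ (π θ))
      (fderiv ℝ (fun θ' => M.occ (π θ')) θ (X.mulVec (M.gradV π θ))) v = pairing M.r v := by
  have : Nonempty A := (hπ.isPolicy θ).nonempty_action M
  obtain ⟨L, -, hL⟩ := M.hasFDerivAt_gradPhiC β hφ2 hd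
  have hsum : ∀ x : Fin p → ℝ, x = ∑ i, x i • Pi.single i (1 : ℝ) := fun x => by
    ext j
    simp [Finset.sum_apply, Pi.single_apply]
  have hG : ∀ x i, (M.gramC β φ π θ).mulVec x i =
      L (M.dOcc π θ i) (fderiv ℝ (fun θ' => M.occ (π θ')) θ x) := by
    intro x i
    conv_rhs => rw [hsum x]
    simp only [Matrix.mulVec, dotProduct, gramC, Matrix.of_apply, map_sum, map_smul, smul_eq_mul,
      M.fderiv_fderiv_PhiC β hφ1 hφ2 hd]
    exact Finset.sum_congr rfl fun _ _ => by rw [mul_comm, hL]; rfl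
  obtain ⟨w, hwT, hw⟩ := M.exists_hessPhiC_eq_pairing hβ hφ hφ2 (hπ.isPolicy θ) hd M.r
  obtain ⟨x, rfl⟩ := M.exists_fderiv_occ_eq hM hπ θ hwT
  -- The parameter direction `x` realizes the representer of the reward, so the gradient lies in the
  -- range of the Gram matrix. There `G X G = G` is all that is needed of the pseudo-inverse.
  have hGx : (M.gramC β φ π θ).mulVec x = M.gradV π θ := by
    ext i
    rw [hG, hL, hessPhiC_comm, M.gradV_apply hπ]
    exact hw _ (M.fderiv_occ_mem hπ θ (Pi.single i 1))
  have hGX : (M.gramC β φ π θ).mulVec (X.mulVec (M.gradV π θ)) = M.gradV π θ := by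
    rw [← hGx, Matrix.mulVec_mulVec, Matrix.mulVec_mulVec, hX]
  obtain ⟨z, rfl⟩ := M.exists_fderiv_occ_eq hM hπ θ hv
  rw [hessPhiC_comm, ← hL, hsum z]
  simp only [map_sum, map_smul, sum_apply, smul_apply]
  refine Finset.sum_congr rfl fun i _ => ?_
  have h1 := (hG (X.mulVec (M.gradV π θ)) i).symm.trans
    ((congrFun hGX i).trans (M.gradV_apply hπ θ i))
  exact congrArg (z i • ·) h1

/-- Along a solution, `∇Φ_C(d_t)` restricted to the tangent space moves with constant velocity. -/
theorem hasDerivWithinAt_gradPhiC_occ [DecidableEq S] (M : CMDP S A ι) (hM : M.Exploration)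
    {β : ι → ℝ} (hβ : ∀ i, 0 < β i) {φ : ℝ → ℝ} (hφ : MonotoneOn (deriv φ) (Ioi 0))
    (hφ1 : DifferentiableOn ℝ φ (Ioi 0)) (hφ2 : DifferentiableOn ℝ (deriv φ) (Ioi 0))
    {π : (Fin p → ℝ) → S → A → ℝ} (hπ : IsRegularParam π)
    {Gplus : (Fin p → ℝ) → Matrix (Fin p) (Fin p) ℝ}
    (hGplus : ∀ θ ∈ M.strictlySafeParams π, IsPseudoInverse (M.gramC β φ π θ) (Gplus θ))
    {I : Set ℝ} {θ : ℝ → Fin p → ℝ} (hθ : M.IsCNPGSolution π Gplus I θ) {t : ℝ} (ht : t ∈ I)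
    (hs : θ t ∈ M.strictlySafeParams π) {v : S × A → ℝ} (hv : v ∈ M.occTangent) :
    HasDerivWithinAt (fun t => M.gradPhiC β φ (M.occ (π (θ t))) v) (pairing M.r v) I t := by
  have : Nonempty A := (hπ.isPolicy 0).nonempty_action M
  have hd : M.occ (π (θ t)) ∈ M.domPhiC :=
    ⟨M.occ_pos hM hπ _, (M.mem_strictlySafeParams_iff hπ _).1 hs⟩
  obtain ⟨L, hL, hLuv⟩ := M.hasFDerivAt_gradPhiC β hφ2 hd
  have h1 : HasDerivWithinAt (fun t => M.occ (π (θ t))) _ I t :=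
    (M.differentiable_occ hπ (θ t)).hasFDerivAt.comp_hasDerivWithinAt t (hθ.hasDeriv t ht hs)
  have h2 : HasDerivWithinAt (fun t => M.gradPhiC β φ (M.occ (π (θ t)))) _ I t :=
    HasFDerivAt.comp_hasDerivWithinAt (l := M.gradPhiC β φ) t hL h1
  refine (h2.clm_apply (hasDerivWithinAt_const t I v)).congr_deriv ?_
  rw [map_zero, add_zero, hLuv,
    M.hessPhiC_naturalGradient hM hβ hφ hφ1 hφ2 hπ hd (hGplus _ hs) hv]

/-! ### Blow-up of the barrier and the exit-time contradiction. -/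

/-- If the slack of a strict constraint vanishes as `t ↑ τ`, then the barrier part of `∇Φ_C`,
tested against the displacement from the limit point, tends to `-∞`. -/
theorem tendsto_sum_barrier_atBot {β : ι → ℝ} (hβ : ∀ i, 0 < β i) {ψ : ℝ → ℝ}
    (hψ : ContinuousOn ψ (Ioi 0)) (hψ0 : Tendsto ψ (𝓝[>] 0) atBot) {l : Filter ℝ}
    {x : ι → ℝ → ℝ} {x₀ x₁ : ι → ℝ} (h₀ : ∀ i, 0 < x₀ i)
    (hx : ∀ i, ∀ᶠ t in l, 0 < x i t) (hlim : ∀ i, Tendsto (x i) l (𝓝 (x₁ i)))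
    (hx₁ : ∀ i, 0 ≤ x₁ i) {j : ι} (hj : x₁ j = 0) :
    Tendsto (fun t => ∑ i, β i * ψ (x i t) * (x₀ i - x₁ i)) l atBot := by
  classical
  have hzero : ∀ i, x₁ i = 0 →
      Tendsto (fun t => β i * ψ (x i t) * (x₀ i - x₁ i)) l atBot := by
    intro i hi
    have h1 : Tendsto (x i) l (𝓝[>] 0) :=
      tendsto_nhdsWithin_iff.2 ⟨hi ▸ hlim i, hx i⟩
    exact ((hψ0.comp h1).const_mul_atBot (hβ i)).atBot_mul_const (by rw [hi, sub_zero]; exact h₀ i)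
  -- An upper bound suffices for the terms other than `j`: those with vanishing slack also tend to
  -- `-∞`, and the rest converge whatever the sign of `x₀ i - x₁ i`.
  have hbdd : ∀ i, ∃ C, ∀ᶠ t in l, β i * ψ (x i t) * (x₀ i - x₁ i) ≤ C := by
    intro i
    rcases (hx₁ i).eq_or_lt with h | h
    · exact ⟨0, (hzero i h.symm).eventually_le_atBot 0⟩
    · have h1 := (((hψ.continuousAt (Ioi_mem_nhds h)).tendsto.comp (hlim i)).const_mul
        (β i)).mul_const (x₀ i - x₁ i)
      exact ⟨_, h1.eventually_le_const (lt_add_one _)⟩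
  choose C hC using hbdd
  simp_rw [← Finset.add_sum_erase _ _ (Finset.mem_univ j)]
  refine tendsto_atBot_add_right_of_ge' l (∑ i ∈ Finset.univ.erase j, C i) (hzero j hj) ?_
  filter_upwards [eventually_all.2 hC] with t ht
  exact Finset.sum_le_sum fun i _ => ht i

theorem gradPhiC_apply (M : CMDP S A ι) (β : ι → ℝ) (φ : ℝ → ℝ) (d v : S × A → ℝ) :
    M.gradPhiC β φ d v = gradPhiK d v +
      ∑ i, β i * deriv φ (M.b i - pairing (M.c i) d) * -pairing (M.c i) v := by
  simp [gradPhiC]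

theorem continuousAt_gradPhiK [Nonempty A] {d : S × A → ℝ} (hd : ∀ x, 0 < d x) :
    ContinuousAt gradPhiK d := by
  refine tendsto_finsetSum _ fun s _ => tendsto_finsetSum _ fun a _ => ?_
  have h1 : ContinuousAt (fun d : S × A → ℝ => d (s, a)) d := (continuous_apply _).continuousAt
  exact ((h1.log (hd _).ne').sub
    ((marginal s).continuous.continuousAt.log (marginal_pos hd s).ne')).smul continuousAt_const

end CMDP

end

theorem mainTheorem2 {S A ι : Type*} [Fintype S] [DecidableEq S] [Fintype A] [Fintype ι]
    (M : CMDP S A ι) (hM : M.Exploration)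
    (β : ι → ℝ) (hβ : ∀ i, 0 < β i)
    (φ : ℝ → ℝ) (hφ_convex : ConvexOn ℝ (Ioi 0) φ)
    (hφ_diff : DifferentiableOn ℝ φ (Ioi 0))
    (hφ_diff2 : DifferentiableOn ℝ (deriv φ) (Ioi 0))
    (hφ_barrier : Tendsto (fun x => |deriv φ x|) (𝓝[>] 0) atTop)
    {p : ℕ} (π : (Fin p → ℝ) → S → A → ℝ) (hπ : CMDP.IsRegularParam π)
    (Gplus : (Fin p → ℝ) → Matrix (Fin p) (Fin p) ℝ)
    (hGplus : ∀ θ ∈ M.strictlySafeParams π,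
      CMDP.IsPseudoInverse (M.gramC β φ π θ) (Gplus θ))
    (I : Set ℝ) (hI : I.OrdConnected) (hI0 : IsLeast I 0)
    (θ : ℝ → Fin p → ℝ) (hθ : M.IsCNPGSolution π Gplus I θ)
    (hθ0 : θ 0 ∈ M.strictlySafeParams π) :
    ∀ t ∈ I, θ t ∈ M.strictlySafeParams π ∧ θ t ∈ M.safeParams π := by
  suffices h : ∀ t ∈ I, θ t ∈ M.strictlySafeParams π from fun t ht =>
    ⟨h t ht, hπ.isPolicy _, fun i => ((h t ht).2 i).le⟩
  intro T hT
  by_contra hexit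
  have : Nonempty A := (hπ.isPolicy 0).nonempty_action M
  have hmono := CMDP.monotoneOn_deriv_of_convexOn hφ_convex hφ_diff
  let d : ℝ → S × A → ℝ := fun t => M.occ (π (θ t))
  let x : ι → ℝ → ℝ := fun i t => M.b i - CMDP.pairing (M.c i) (d t)
  have hdc : ContinuousOn d I :=
    (M.differentiable_occ hπ).continuous.comp_continuousOn hθ.continuousOn
  have hxc : ∀ i, ContinuousOn (x i) I := fun i =>
    continuousOn_const.sub ((CMDP.pairing (M.c i)).continuous.comp_continuousOn hdc)
  have hsafe : ∀ t, θ t ∈ M.strictlySafeParams π ↔ ∀ i, 0 < x i t := fun t =>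
    M.mem_strictlySafeParams_iff hπ (θ t)
  have hsub : Icc 0 T ⊆ I := hI.out hI0.1 hT
  -- the first time at which some constraint is active
  let Z : Set ℝ := ⋃ i, {t | t ∈ Icc 0 T ∧ x i t ≤ 0}
  have hZmem : ∀ t ∈ Icc 0 T, t ∈ Z ↔ θ t ∉ M.strictlySafeParams π := by
    intro t ht
    simp only [Z, mem_iUnion, mem_ofPred_eq, ht, true_and, hsafe, not_forall, not_lt]
  have hZsub : Z ⊆ Icc 0 T := iUnion_subset fun i t ht => ht.1
  have hZc : IsClosed Z := isClosed_iUnion_of_finite fun i =>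
    ((hxc i).mono hsub).preimage_isClosed_of_isClosed isClosed_Icc isClosed_Iic
  have hZne : Z.Nonempty := ⟨T, (hZmem T ⟨hI0.2 hT, le_rfl⟩).2 hexit⟩
  have hZb : BddBelow Z := ⟨0, fun t ht => (hZsub ht).1⟩
  obtain ⟨τ, hτ⟩ : ∃ τ, τ = sInf Z := ⟨_, rfl⟩
  have hτZ : τ ∈ Z := hτ ▸ hZc.csInf_mem hZne hZb
  have hτT := hZsub hτZ
  have hτ0 : 0 < τ := by
    refine hτT.1.lt_of_ne fun h => ?_
    exact (hZmem τ hτT).1 hτZ (h ▸ hθ0)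
  have hbefore : ∀ t ∈ Ico 0 τ, θ t ∈ M.strictlySafeParams π := by
    intro t ht
    by_contra h
    exact absurd (csInf_le hZb ((hZmem t ⟨ht.1, ht.2.le.trans hτT.2⟩).2 h))
      (not_le.2 (hτ ▸ ht.2))
  have hIcoI : Ico 0 τ ⊆ I := fun t ht => hsub ⟨ht.1, ht.2.le.trans hτT.2⟩
  have hlim : Tendsto d (𝓝[<] τ) (𝓝 (d τ)) := by
    refine (hdc τ (hsub hτT)).mono_left ?_
    rw [← nhdsWithin_Ico_eq_nhdsLT hτ0]
    exact nhdsWithin_mono _ hIcoI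
  have hev : ∀ᶠ t in 𝓝[<] τ, t ∈ Ico 0 τ := Ico_mem_nhdsLT hτ0
  have hxlim : ∀ i, Tendsto (x i) (𝓝[<] τ) (𝓝 (x i τ)) := fun i =>
    tendsto_const_nhds.sub (((CMDP.pairing (M.c i)).continuous.tendsto _).comp hlim)
  have hxpos : ∀ i, ∀ᶠ t in 𝓝[<] τ, 0 < x i t := fun i =>
    hev.mono fun t ht => (hsafe t).1 (hbefore t ht) i
  have hxτ : ∀ i, 0 ≤ x i τ := fun i =>
    ge_of_tendsto (hxlim i) ((hxpos i).mono fun _ h => h.le)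
  obtain ⟨j, -, hj⟩ := mem_iUnion.1 hτZ
  -- This choice is tangent and gives `-c_i·v = x_i(0) - x_i(τ)`, which is strictly positive at
  -- every constraint active at `τ`.
  let v : S × A → ℝ := d 0 - d τ
  have hv : v ∈ M.occTangent := M.occ_sub_occ_mem (hπ.isPolicy _) (hπ.isPolicy _)
  have hbar := CMDP.tendsto_sum_barrier_atBot hβ hφ_diff2.continuousOn
    (CMDP.tendsto_deriv_atBot_of_barrier hmono hφ_barrier) ((hsafe 0).1 hθ0) hxpos hxlim hxτ
    (le_antisymm hj (hxτ j))
  -- conservation law up to the exit time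
  have hcons : ∀ t ∈ Ico 0 τ, M.gradPhiC β φ (d t) v =
      M.gradPhiC β φ (d 0) v + t * CMDP.pairing M.r v := by
    intro t ht
    have hder : ∀ s ∈ Icc 0 t, HasDerivWithinAt
        (fun s => M.gradPhiC β φ (d s) v - s * CMDP.pairing M.r v) 0 (Icc 0 t) s := by
      intro s hs
      have hs' : s ∈ Ico 0 τ := ⟨hs.1, hs.2.trans_lt ht.2⟩
      have h1 := (M.hasDerivWithinAt_gradPhiC_occ hM hβ hmono hφ_diff hφ_diff2 hπ hGplus hθ
        (hIcoI hs') (hbefore s hs') hv).sub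
          ((hasDerivWithinAt_id s I).mul_const (CMDP.pairing M.r v))
      rw [one_mul, sub_self] at h1
      exact h1.mono fun u hu => hIcoI ⟨hu.1, hu.2.trans_lt ht.2⟩
    have h2 := constant_of_has_deriv_right_zero (fun s hs => (hder s hs).continuousWithinAt)
      (fun s hs => (hder s ⟨hs.1, hs.2.le⟩).mono_of_mem_nhdsWithin (Icc_mem_nhdsGE_of_mem hs))
      t (right_mem_Icc.2 ht.1)
    simp only [zero_mul, sub_zero] at h2
    linarith
  -- The limit `θ τ` is still a parameter, so `d τ` is strictly positive and the logarithms in the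
  -- entropy gradient stay finite.
  have hK : Tendsto (fun t => CMDP.gradPhiK (d t) v) (𝓝[<] τ) (𝓝 (CMDP.gradPhiK (d τ) v)) :=
    ((ContinuousLinearMap.apply ℝ ℝ v).continuous.tendsto _).comp
      ((CMDP.continuousAt_gradPhiK (M.occ_pos hM hπ (θ τ))).tendsto.comp hlim)
  have hlin : Tendsto (fun t => M.gradPhiC β φ (d 0) v + t * CMDP.pairing M.r v) (𝓝[<] τ)
      (𝓝 (M.gradPhiC β φ (d 0) v + τ * CMDP.pairing M.r v)) :=
    (Continuous.tendsto (by fun_prop) τ).mono_left nhdsWithin_le_nhds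
  -- By the conservation law the barrier sum is an affine function of `t` minus the entropy part, so
  -- it has a finite limit at `τ`.
  refine not_tendsto_nhds_of_tendsto_atBot hbar _ ((hlin.sub hK).congr' ?_)
  filter_upwards [hev] with t ht
  rw [← hcons t ht, CMDP.gradPhiC_apply, add_sub_cancel_left]
  refine Finset.sum_congr rfl fun i _ => ?_
  congr 1
  simp only [v, x, map_sub]
  ring
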